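/- **Setting.** A semi-Markov decision process with terminal costs consists of: a state space $E$ (a standard Borel space); a countable action set $A$ (with the discrete $\sigma$-algebra); for every $x\in E$ a finite set $A(x)\subset A$ of admissible actions, such that $K=\{(x,a): x\in E,\ a\in A(x)\}$ is measurable in $E\times A$ and there is a measurable $f:\mathbb R\times E\to A$ with $f(t,x)\in A(x)$ for all $(t,x)$; a semi-Markov kernel $Q(dt,dy\mid x,a)$, i.e. a stochastic kernel on $\mathbb R_+\times E$ given $K$ with $Q(0,E\mid x,a)=0$, where $\mathbb R_+=[0,\infty)$ and $Q(t,B\mid x,a):=Q([0,t]\times B\mid x,a)$; and measurable functions $c,g:K\to[0,\infty)$ (cost rate and terminal cost). An admissible history is $h_n=(x_0,a_0,t_1,x_1,\dots,a_{n-1},t_n,x_n)\in H_n=(K\times\mathbb R_+)^n\times E$. A policy $\pi=(\pi_n)_{n\ge0}$ is a sequence of stochastic kernels $\pi_n$ on $A$ given $\mathbb R\times H_n$ with $\pi_n(A(x_n)\mid s,h_n)=1$; the set of policies is $\Pi$. For $(s,x)\in\mathbb R\times E$ and $\pi\in\Pi$ let $P^\pi_{(s,x)}$ be the law (Ionescu-Tulcea)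 of the random sequence $(X_0,A_0,T_1,X_1,A_1,T_2,\dots)$ with $X_0=x$ in which, with $S_n=T_1+\dots+T_n$ and $S_0=0$, given the history $h_n$ up to $X_n$ the action $A_n$ has law $\pi_n(\cdot\mid s-S_n,h_n)$, and given in addition $A_n$ the pair $(T_{n+1},X_{n+1})$ has law $Q(\cdot\mid X_n,A_n)$. Put $(X(t),A(t))=(X_n,A_n)$ for $S_n\le t<S_{n+1}$; for $t\ge\lim_n S_n$ the process is in a cemetery state, where the costs are $0$. For $s\ge 0$ define $$U^\pi(s,x)=E^\pi_{(s,x)}\Big[\int_0^s c(X(t),A(t))\,dt+g(X(s),A(s))\Big],\qquad U^*(s,x)=\inf_{\pi\in\Pi}U^\pi(s,x).$$ Fix $T\in[0,\infty)$. A policy $\pi$ is $T$-horizon optimal if $U^\pi=U^*$ on $[0,T]\times E$. Let $\mathbb M$ be the set of measurable functions $v:[0,T]\times E\to[0,\infty]$. For $v\in\mathbb M$ and $(s,x)\in[0,T]\times E$ put, for $a\in A(x)$, $$\mathbb T^a v(s,x)=c(x,a)\int_0^s\big(1-Q(t,E\mid x,a)\big)dt+g(x,a)\big(1-Q(s,E\mid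 x,a)\big)+\int_{[0,s]}\int_E v(s-t,y)\,Q(dt,dy\mid x,a)$$ (and $\mathbb T^av(s,x)=+\infty$ if $a\notin A(x)$), and $\mathbb T v(s,x)=\min_{a\in A(x)}\mathbb T^a v(s,x)$. Let $\mathbb F$ be the set of measurable $f:\mathbb R\times E\to A$ with $f(s,x)\in A(x)$ for all $(s,x)$. For $f\in\mathbb F$ put $\mathbb T^f v(s,x)=\mathbb T^{f(s,x)}v(s,x)$, and identify $f$ with the deterministic stationary policy $\pi_n(\cdot\mid s,h_n)=\delta_{f(s,x_n)}$. **Theorem.** Suppose that $P^\pi_{(s,x)}(\lim_{n\to\infty}S_n=\infty)=1$ for all $(s,x)\in\mathbb R\times E$ and $\pi\in\Pi$. Then, with all functions considered on $[0,T]\times E$: (a) (Value iteration) Let $U^*_0=0$ and $U^*_{n+1}=\mathbb T U^*_n$ for $n\ge0$. Then all $U_n^*$ and $U^*$ belong to $\mathbb M$, the sequence $(U^*_n)$ is nondecreasing, and $U^*=\lim_{n\to\infty}U^*_n$ pointwise. (b) (Optimality equation) $U^*=\mathbb T U^*$, and $U^*$ is the minimum solution in $\mathbb M$: if $u\in\mathbb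 M$ satisfies $u=\mathbb T u$, then $u\ge U^*$. (c) (Optimal policy) There is an $f^*\in\mathbb F$ with $U^*=\mathbb T^{f^*}U^*$, and every $f^*\in\mathbb F$ with $U^*=\mathbb T^{f^*}U^*$ is $T$-horizon optimal. -/

import Mathlib

open MeasureTheory ProbabilityTheory Filter Topology
open scoped NNReal ENNReal

/-- A semi-Markov decision process with cost rates and terminal costs.  The state space `E` is a
standard Borel space, the action set `A` is countable and carries the discrete `σ`-algebra.
`adm x` is the finite set `A(x)` of admissible actions at `x`. -/
structure SMDP (E A : Type*) [MeasurableSpace E] [MeasurableSpace A] where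
  /-- the finite set `A(x)` of admissible actions -/
  adm : E → Finset A
  /-- the set `K` of admissible state-action pairs is measurable -/
  measurableSet_graph : MeasurableSet {p : E × A | p.2 ∈ adm p.1}
  /-- there is a measurable admissible selector -/
  exists_selector : ∃ f : ℝ × E → A, Measurable f ∧ ∀ (t : ℝ) (x : E), f (t, x) ∈ adm x
  /-- the semi-Markov kernel `Q(dt, dy | x, a)` on `[0, ∞) × E` given `K`; its distribution
  function in time is `Q(t, B | x, a) = Q(· | x, a) ([0, t] × B)` -/
  Q : Kernel {p : E × A // p.2 ∈ adm p.1} (ℝ≥0 × E)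
  markov_Q : IsMarkovKernel Q
  /-- `Q(0, E | x, a) = 0` -/
  Q_zero : ∀ k, Q k (Set.Iic 0 ×ˢ Set.univ) = 0
  /-- the cost rate `c(x, a)` on `K` -/
  cost : {p : E × A // p.2 ∈ adm p.1} → ℝ≥0
  measurable_cost : Measurable cost
  /-- the terminal cost `g(x, a)` on `K` -/
  term : {p : E × A // p.2 ∈ adm p.1} → ℝ≥0
  measurable_term : Measurable term

namespace SMDP

attribute [instance] SMDP.markov_Q

variable {E A : Type*} [MeasurableSpace E] [MeasurableSpace A]

/-- The set `K` of admissible state-action pairs. -/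
abbrev K (M : SMDP E A) : Type _ := {p : E × A // p.2 ∈ M.adm p.1}

/-- The distribution function `Q(t, B | x, a)` of the semi-Markov kernel. -/
noncomputable def semiQ (M : SMDP E A) (t : ℝ≥0) (B : Set E) (k : M.K) : ℝ≥0∞ :=
  M.Q k (Set.Iic t ×ˢ B)

/-- Admissible histories `h_n = (x_0, a_0, t_1, x_1, …, a_{n-1}, t_n, x_n)`: the `i`-th entry of the
first component is `((x_i, a_i), t_{i+1})`, and the second component is `x_n`. -/
abbrev Hist (M : SMDP E A) (n : ℕ) : Type _ := (Fin n → M.K × ℝ≥0) × E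

/-- A (randomized, history- and horizon-dependent) policy: a sequence of stochastic kernels `π_n` on
`A` given `ℝ × H_n` with `π_n (A(x_n) | s, h_n) = 1`. -/
structure Policy (M : SMDP E A) where
  kernel : ∀ n : ℕ, Kernel (ℝ × M.Hist n) A
  markov : ∀ n, IsMarkovKernel (kernel n)
  admissible : ∀ (n : ℕ) (s : ℝ) (h : M.Hist n), kernel n (s, h) (M.adm h.2 : Set A) = 1

attribute [instance] Policy.markov

/-- The class `Φ` of stochastic kernels `φ` on `A` given `ℝ × E` with `φ(A(x) | s, x) = 1`. -/
structure RandSelector (M : SMDP E A) where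
  kernel : Kernel (ℝ × E) A
  markov : IsMarkovKernel kernel
  admissible : ∀ (s : ℝ) (x : E), kernel (s, x) (M.adm x : Set A) = 1

attribute [instance] RandSelector.markov

/-- The class `F` of measurable maps `f : ℝ × E → A` with `f (s, x) ∈ A(x)`. -/
structure Selector (M : SMDP E A) where
  toFun : ℝ × E → A
  measurable : Measurable toFun
  admissible : ∀ (s : ℝ) (x : E), toFun (s, x) ∈ M.adm x

/-- A deterministic selector as the randomized selector `δ_{f(s, x)}`. -/
noncomputable def Selector.toRand {M : SMDP E A} (f : M.Selector) : M.RandSelector where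
  kernel := Kernel.deterministic f.toFun f.measurable
  markov := inferInstance
  admissible s x := by
    rw [Kernel.deterministic_apply, Measure.dirac_apply_of_mem]
    exact f.admissible s x

/-- The randomized stationary policy given by `φ ∈ Φ`: `π_n(· | s, h_n) = φ(· | s, x_n)`. -/
noncomputable def RandSelector.policy {M : SMDP E A} (φ : M.RandSelector) : M.Policy where
  kernel n := φ.kernel.comap (fun p : ℝ × M.Hist n => (p.1, p.2.2)) (by fun_prop)
  markov n := inferInstance
  admissible n s h := by
    rw [Kernel.comap_apply]
    exact φ.admissible s h.2

/-- The deterministic stationary policy given by `f ∈ F`. -/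
noncomputable def Selector.policy {M : SMDP E A} (f : M.Selector) : M.Policy := f.toRand.policy

section Path

variable (M : SMDP E A)

/-- One step of a trajectory: `(t_n, (x_n, a_n))`, the sojourn time that ends at the `n`-th decision
epoch (a dummy coordinate, with value `0`, for `n = 0`), the state and the action at that epoch. -/
abbrev Step : Type _ := ℝ≥0 × M.K

/-- Sample paths `(x_0, a_0, t_1, x_1, a_1, t_2, …)`, with the product `σ`-algebra. -/
abbrev Path : Type _ := ℕ → M.Step

/-- The inclusion of steps into `([0, ∞) × E) × A`. -/
def Step.incl (z : M.Step) : (ℝ≥0 × E) × A := ((z.1, z.2.1.1), z.2.1.2)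

variable {M}

lemma Step.range_incl :
    Set.range (Step.incl M) = {q : (ℝ≥0 × E) × A | q.2 ∈ M.adm q.1.2} := by
  ext q
  constructor
  · rintro ⟨z, rfl⟩
    exact z.2.2
  · intro hq
    exact ⟨(q.1.1, ⟨(q.1.2, q.2), hq⟩), rfl⟩

lemma Step.measurableSet_range_incl : MeasurableSet (Set.range (Step.incl M)) := by
  rw [Step.range_incl]
  have : Measurable (fun q : (ℝ≥0 × E) × A => (q.1.2, q.2)) := by fun_prop
  exact this M.measurableSet_graph

lemma Step.measurableEmbedding_incl : MeasurableEmbedding (Step.incl M) := by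
  refine MeasurableEmbedding.of_measurable_inverse_on_range (g := fun q => (q.1.1.1,
    ⟨(q.1.1.2, q.1.2), (Step.range_incl (M := M)).subset q.2⟩)) ?_ ?_ ?_ ?_
  · unfold Step.incl
    fun_prop
  · exact Step.measurableSet_range_incl
  · fun_prop
  · intro z
    rfl

variable (M)

/-- The joint law of `(t, x, a)` when `(t, x)` is drawn from `ρ` and then the action `a ∈ A(x)` is
drawn from `η`, given the same parameter and `(t, x)`. -/
noncomputable def stepLaw {B : Type*} [MeasurableSpace B] (ρ : Kernel B (ℝ≥0 × E))
    (η : Kernel (B × (ℝ≥0 × E)) A) : Kernel B M.Step :=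
  (ρ ⊗ₖ η).comapRight Step.measurableEmbedding_incl

lemma isMarkovKernel_stepLaw {B : Type*} [MeasurableSpace B] (ρ : Kernel B (ℝ≥0 × E))
    [IsMarkovKernel ρ] (η : Kernel (B × (ℝ≥0 × E)) A) [IsMarkovKernel η]
    (h : ∀ b t x, η (b, (t, x)) (M.adm x : Set A) = 1) : IsMarkovKernel (M.stepLaw ρ η) := by
  refine Kernel.IsMarkovKernel.comapRight _ _ fun b => ?_
  rw [Kernel.compProd_apply Step.measurableSet_range_incl, Step.range_incl]
  have : ∀ q : ℝ≥0 × E,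
      η (b, q) (Prod.mk q ⁻¹' {q : (ℝ≥0 × E) × A | q.2 ∈ M.adm q.1.2}) = 1 :=
    fun q => h b q.1 q.2
  exact (lintegral_congr this).trans (by simp)

/-- The remaining horizon `s - (t_1 + ⋯ + t_n + t)` after the sojourn times `t_1, …, t_n` recorded in
a path prefix and a further sojourn time `t`. -/
noncomputable def remaining (s : ℝ) (n : ℕ) (z : Π _ : Finset.Iic n, M.Step) (t : ℝ≥0) : ℝ :=
  s - ((∑ i : Fin n, (z ⟨i + 1, Finset.mem_Iic.2 i.2⟩).1) + t : ℝ≥0)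

/-- The history `(x_0, a_0, t_1, …, x_n, a_n, t, x)` formed by a path prefix up to epoch `n` and a
further sojourn time `t` and state `x`. -/
def extendHist (n : ℕ) (z : Π _ : Finset.Iic n, M.Step) (t : ℝ≥0) (x : E) : M.Hist (n + 1) :=
  (fun i => ((z ⟨i, Finset.mem_Iic.2 (Nat.lt_succ_iff.1 i.2)⟩).2,
    if h : (i : ℕ) + 1 ≤ n then (z ⟨i + 1, Finset.mem_Iic.2 h⟩).1 else t), x)

lemma measurable_remaining_extendHist (s : ℝ) (n : ℕ) :
    Measurable (fun p : (Π _ : Finset.Iic n, M.Step) × (ℝ≥0 × E) =>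
      (M.remaining s n p.1 p.2.1, M.extendHist n p.1 p.2.1 p.2.2)) := by
  unfold remaining extendHist
  refine Measurable.prodMk (by fun_prop) (Measurable.prodMk ?_ (by fun_prop))
  refine measurable_pi_lambda _ fun i => Measurable.prodMk (by fun_prop) ?_
  by_cases h : (i : ℕ) + 1 ≤ n
  · simp only [h, dite_true]
    fun_prop
  · simp only [h, dite_false]
    fun_prop

variable {M}

/-- The transition kernel of the controlled process from the path prefix up to epoch `n` to the step
`n + 1`: `(t_{n+1}, x_{n+1})` has law `Q(· | x_n, a_n)`, and then `a_{n+1}` has law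
`π_{n+1}(· | s - S_{n+1}, h_{n+1})`. -/
noncomputable def Policy.transition (π : M.Policy) (s : ℝ) (n : ℕ) :
    Kernel (Π _ : Finset.Iic n, M.Step) M.Step :=
  M.stepLaw
    (M.Q.comap (fun z => (z ⟨n, Finset.mem_Iic.2 le_rfl⟩).2) (by fun_prop))
    ((π.kernel (n + 1)).comap _ (M.measurable_remaining_extendHist s n))

instance (π : M.Policy) (s : ℝ) (n : ℕ) : IsMarkovKernel (π.transition s n) :=
  M.isMarkovKernel_stepLaw _ _ fun z t x =>
    π.admissible (n + 1) (M.remaining s n z t) (M.extendHist n z t x)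

/-- The law of the initial step: `x_0 = x`, and `a_0` has law `π_0(· | s, x)`. -/
noncomputable def Policy.initial (π : M.Policy) (s : ℝ) (x : E) : Measure M.Step :=
  M.stepLaw (Kernel.const Unit (Measure.dirac ((0 : ℝ≥0), x)))
    ((π.kernel 0).comap (fun q : Unit × (ℝ≥0 × E) => (s, (Fin.elim0, q.2.2))) (by fun_prop)) ()

/-- The probability measure `P^π_{(s,x)}` on the space of sample paths (Ionescu-Tulcea). -/
noncomputable def Policy.law (π : M.Policy) (s : ℝ) (x : E) : Measure M.Path :=
  Kernel.trajMeasure (X := fun _ => M.Step) (π.initial s x) (π.transition s)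

/-- The `n`-th jump time `S_n = t_1 + ⋯ + t_n`, `S_0 = 0`. -/
noncomputable def jumpTime (ω : M.Path) (n : ℕ) : ℝ≥0 := ∑ i ∈ Finset.range n, (ω (i + 1)).1

open Classical in
/-- The state-action process `(X(t), A(t))`: it is `(x_n, a_n)` for `S_n ≤ t < S_{n+1}`, and the
cemetery `none` for `t ≥ lim S_n`. -/
noncomputable def process (ω : M.Path) (t : ℝ≥0) : Option M.K :=
  if h : ∃ n, jumpTime ω n ≤ t ∧ t < jumpTime ω (n + 1) then some (ω (Nat.find h)).2 else none

variable (M)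

/-- The jump times do not accumulate: `P^π_{(s,x)}(S_n → ∞) = 1` for all `s`, `x` and `π`. -/
def NonExplosive : Prop :=
  ∀ (s : ℝ) (x : E) (π : M.Policy),
    ∀ᵐ ω ∂(π.law s x), Tendsto (fun n => jumpTime ω n) atTop atTop

/-- The cost rate, extended by `0` to the cemetery. -/
noncomputable def costOpt (o : Option M.K) : ℝ≥0∞ := o.elim 0 fun k => (M.cost k : ℝ≥0∞)

/-- The terminal cost, extended by `0` to the cemetery. -/
noncomputable def termOpt (o : Option M.K) : ℝ≥0∞ := o.elim 0 fun k => (M.term k : ℝ≥0∞)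

variable {M}

/-- The expected cost
`U^π(s, x) = E^π_{(s,x)} [∫_0^s c(X(t), A(t)) dt + g(X(s), A(s))]`, for `s ≥ 0`. -/
noncomputable def Policy.expCost (π : M.Policy) (s : ℝ≥0) (x : E) : ℝ≥0∞ :=
  ∫⁻ ω, ((∫⁻ t in Set.Icc (0 : ℝ) s, M.costOpt (process ω t.toNNReal)) +
    M.termOpt (process ω s)) ∂(π.law s x)

variable (M)

/-- The value function `U^*(s, x) = inf_π U^π(s, x)` on `[0, ∞) × E`. -/
noncomputable def value (s : ℝ≥0) (x : E) : ℝ≥0∞ := ⨅ π : M.Policy, π.expCost s x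

/-- The value function as a function on `[0, T] × E`. -/
noncomputable def valueOn (T : ℝ≥0) (p : Set.Iic T × E) : ℝ≥0∞ := M.value p.1 p.2

variable {M}

/-- A policy is `T`-horizon optimal if `U^π = U^*` on `[0, T] × E`. -/
def Policy.IsOptimal (π : M.Policy) (T : ℝ≥0) : Prop :=
  ∀ s : ℝ≥0, s ≤ T → ∀ x : E, π.expCost s x = M.value s x

end Path

section Operators

variable (M : SMDP E A) {T : ℝ≥0}

open Classical in
/-- The operator `𝕋^a`: for `a ∈ A(x)`,
`𝕋^a v (s, x) = c(x,a) ∫_0^s (1 - Q(t, E | x, a)) dt + g(x,a) (1 - Q(s, E | x, a))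
  + ∫_{[0,s]} ∫_E v(s - t, y) Q(dt, dy | x, a)`, and `𝕋^a v (s, x) = ∞` for `a ∉ A(x)`. -/
noncomputable def opAct (a : A) (v : Set.Iic T × E → ℝ≥0∞) (p : Set.Iic T × E) : ℝ≥0∞ :=
  if h : a ∈ M.adm p.2 then
    M.cost ⟨(p.2, a), h⟩ *
        (∫⁻ t in Set.Icc (0 : ℝ) (p.1 : ℝ≥0), (1 - M.semiQ t.toNNReal Set.univ ⟨(p.2, a), h⟩)) +
      M.term ⟨(p.2, a), h⟩ * (1 - M.semiQ p.1 Set.univ ⟨(p.2, a), h⟩) +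
      ∫⁻ q in Set.Iic (p.1 : ℝ≥0) ×ˢ Set.univ,
        v (⟨(p.1 : ℝ≥0) - q.1, Set.mem_Iic.2 (le_trans tsub_le_self p.1.2)⟩, q.2) ∂(M.Q ⟨(p.2, a), h⟩)
  else ⊤

/-- The operator `𝕋^φ v (s, x) = ∑_{a ∈ A(x)} φ(a | s, x) 𝕋^a v (s, x)` for `φ ∈ Φ`. -/
noncomputable def opRand (φ : M.RandSelector) (v : Set.Iic T × E → ℝ≥0∞) (p : Set.Iic T × E) :
    ℝ≥0∞ :=
  ∑ a ∈ M.adm p.2, φ.kernel (((p.1 : ℝ≥0) : ℝ), p.2) {a} * M.opAct a v p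

/-- The optimality operator `𝕋 v (s, x) = min_{a ∈ A(x)} 𝕋^a v (s, x)`. -/
noncomputable def opMin (v : Set.Iic T × E → ℝ≥0∞) (p : Set.Iic T × E) : ℝ≥0∞ :=
  (M.adm p.2).inf fun a => M.opAct a v p

/-- The operator `𝕋^f` of a deterministic selector `f ∈ F`, viewed as an element of `Φ`. -/
noncomputable def opSel (f : M.Selector) (v : Set.Iic T × E → ℝ≥0∞) : Set.Iic T × E → ℝ≥0∞ :=
  M.opRand f.toRand v

/-- Value iteration: `U^*_0 = 0`, `U^*_{n+1} = 𝕋 U^*_n`. -/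
noncomputable def valueIter (T : ℝ≥0) : ℕ → Set.Iic T × E → ℝ≥0∞
  | 0 => fun _ => 0
  | n + 1 => M.opMin (valueIter T n)

end Operators

end SMDP

/-!
Value iteration, the optimality equation and optimal stationary policies for the finite-horizon cost
of a semi-Markov decision process.

With `S_n` the jump times, the cost of a path up to the horizon `s` is the sum over `n` of the cost
incurred between the `n`-th and the `(n+1)`-st decision epoch (`stageCost`,
`totalCost_eq_tsum_stageCost`). Let `D_n(v) = v (s - S_n, x_n)` if `S_n ≤ s` and `D_n(v) = 0`
otherwise. Given the past up to `(x_n, a_n)`, the pair `(t_{n+1}, x_{n+1})` has law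
`Q(· | x_n, a_n)` under every policy, and by Tonelli this yields the one-step identity
`E[stageCost_n] + E[D_{n+1}(v)] = E[1_{S_n ≤ s} (𝕋^{a_n} v) (s - S_n, x_n)]`
(`lintegral_stageCost_add_atJump`). Working with the law of the whole trajectory, rather than with a
policy restarted after the first jump, makes history dependence harmless. Two consequences follow.

* For any policy, `𝕋^a ≥ 𝕋` gives `E[D_n(𝕋 v)] ≤ E[stageCost_n] + E[D_{n+1}(v)]`. Iterating from
  `v = 0` shows that the value iterates are lower bounds for the cost
  (`valueIter_le_expCost`).
* For a selector `f` with `u = 𝕋^f u`, the identity telescopes to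
  `E[stageCost_0 + ⋯ + stageCost_{n-1}] + E[D_n(u)] = u(s, x)`, so the cost of `f` is at most `u`
  (`expCost_le_of_eq_opSel`).

As the action sets are finite, `𝕋` commutes with monotone limits (`opMin_iSup`), so the limit of the
value iterates is a fixed point of `𝕋`. A measurable minimizing selector exists because the action
set is countable. The two bounds then identify the limit with the value function
(`valueOn_eq_iSup_valueIter`), and the second one with `u = U^*` gives optimality of every
minimizing selector. The cemetery carries no cost, so the splitting along the jumps holds on every
path.
-/

namespace SMDP

variable {E A : Type*} [MeasurableSpace E] [MeasurableSpace A]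

/-! ### The one-step cost operator as an integral against the semi-Markov kernel -/

section OneStep

variable (M : SMDP E A) {T : ℝ≥0}

/-- The value `𝕋^a v (r, x)` at an admissible pair `k = (x, a)`, with `r` the remaining horizon. -/
noncomputable def opPair (v : Set.Iic T × E → ℝ≥0∞) (r : Set.Iic T) (k : M.K) : ℝ≥0∞ :=
  M.cost k * (∫⁻ t in Set.Icc (0 : ℝ) (r : ℝ≥0), (1 - M.semiQ t.toNNReal Set.univ k)) +
    M.term k * (1 - M.semiQ r Set.univ k) +
    ∫⁻ q in Set.Iic (r : ℝ≥0) ×ˢ Set.univ,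
      v (⟨(r : ℝ≥0) - q.1, Set.mem_Iic.2 (le_trans tsub_le_self r.2)⟩, q.2) ∂(M.Q k)

/-- The cost incurred at the pair `k` during a sojourn of length `τ` when the remaining horizon is
`r`: the running cost up to `min τ r`, and the terminal cost if the horizon is reached before the
next jump. -/
noncomputable def sojournCost (k : M.K) (r τ : ℝ≥0) : ℝ≥0∞ :=
  M.cost k * (min τ r : ℝ≥0) + M.term k * (if r < τ then 1 else 0)

/-- For `q = (σ, y)`, the value `v (r - σ, y)` if the jump time `σ` does not exceed the horizon `r`,
and `0` otherwise. -/
noncomputable def atJump (v : Set.Iic T × E → ℝ≥0∞) (r : Set.Iic T) (q : ℝ≥0 × E) : ℝ≥0∞ :=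
  if q.1 ≤ r then v (⟨(r : ℝ≥0) - q.1, Set.mem_Iic.2 (le_trans tsub_le_self r.2)⟩, q.2) else 0

variable {M}

lemma opAct_of_mem {a : A} {v : Set.Iic T × E → ℝ≥0∞} {p : Set.Iic T × E} (h : a ∈ M.adm p.2) :
    M.opAct a v p = M.opPair v p.1 ⟨(p.2, a), h⟩ := by
  rw [opAct, dif_pos h, opPair]

lemma opAct_of_notMem {a : A} {v : Set.Iic T × E → ℝ≥0∞} {p : Set.Iic T × E}
    (h : a ∉ M.adm p.2) : M.opAct a v p = ⊤ := by
  rw [opAct, dif_neg h]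

lemma measurable_sojournCost :
    Measurable (fun p : M.K × ℝ≥0 × ℝ≥0 => M.sojournCost p.1 p.2.1 p.2.2) := by
  have h1 := M.measurable_cost
  have h2 := M.measurable_term
  unfold sojournCost
  have : Measurable (fun p : M.K × ℝ≥0 × ℝ≥0 => if p.2.1 < p.2.2 then (1 : ℝ≥0∞) else 0) :=
    Measurable.ite (measurableSet_lt (by fun_prop) (by fun_prop)) (by fun_prop) (by fun_prop)
  fun_prop

lemma measurable_atJump {v : Set.Iic T × E → ℝ≥0∞} (hv : Measurable v) :
    Measurable (fun p : Set.Iic T × ℝ≥0 × E => atJump v p.1 p.2) := by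
  unfold atJump
  refine Measurable.ite (measurableSet_le (by fun_prop) (by fun_prop)) ?_ (by fun_prop)
  exact hv.comp (by fun_prop)

lemma one_sub_semiQ (t : ℝ≥0) (k : M.K) :
    1 - M.semiQ t Set.univ k = ∫⁻ q, (if t < q.1 then 1 else 0) ∂(M.Q k) := by
  have hs : MeasurableSet (Set.Iic t ×ˢ (Set.univ : Set E)) := measurableSet_Iic.prod .univ
  rw [semiQ, ← prob_compl_eq_one_sub hs, ← lintegral_indicator_one hs.compl]
  refine lintegral_congr fun q => ?_
  by_cases h : t < q.1 <;> simp [Set.indicator, h]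

/-- Tonelli: the integrated survival function up to `r` is the mean of `min τ r`. -/
lemma lintegral_one_sub_semiQ (r : ℝ≥0) (k : M.K) :
    ∫⁻ t in Set.Icc (0 : ℝ) r, (1 - M.semiQ t.toNNReal Set.univ k) =
      ∫⁻ q, ((min q.1 r : ℝ≥0) : ℝ≥0∞) ∂(M.Q k) := by
  simp_rw [one_sub_semiQ]
  rw [lintegral_lintegral_swap]
  · refine lintegral_congr fun q => ?_
    have hset : MeasurableSet {t : ℝ | t.toNNReal < q.1} :=
      measurableSet_lt (by fun_prop) (by fun_prop)
    have h1 : ∀ t : ℝ, (if t.toNNReal < q.1 then (1 : ℝ≥0∞) else 0) =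
        {t : ℝ | t.toNNReal < q.1}.indicator 1 t := fun t => by simp [Set.indicator]
    simp_rw [h1]
    rw [lintegral_indicator_one hset, Measure.restrict_apply hset]
    apply le_antisymm
    · calc _ ≤ volume (Set.Icc (0 : ℝ) (min q.1 r : ℝ≥0)) := by
            refine measure_mono fun t ht => ⟨ht.2.1, ?_⟩
            have h3 : t.toNNReal < q.1 := ht.1
            have h4 : t < q.1 := (Real.toNNReal_lt_iff_lt_coe ht.2.1).1 h3
            simpa using ⟨h4.le, ht.2.2⟩
        _ = _ := by simp [Real.volume_Icc, ENNReal.ofReal_coe_nnreal, -NNReal.coe_min]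
    · calc _ = volume (Set.Ico (0 : ℝ) (min q.1 r : ℝ≥0)) := by
            simp [Real.volume_Ico, ENNReal.ofReal_coe_nnreal, -NNReal.coe_min]
        _ ≤ _ := by
            refine measure_mono fun t ht => ?_
            have h2 := ht.2
            simp only [NNReal.coe_min, lt_min_iff] at h2
            exact ⟨(Real.toNNReal_lt_iff_lt_coe ht.1).2 h2.1, ht.1, h2.2.le⟩
  · refine Measurable.aemeasurable ?_
    exact Measurable.ite (measurableSet_lt (by fun_prop) (by fun_prop)) (by fun_prop) (by fun_prop)

lemma opPair_eq_lintegral (v : Set.Iic T × E → ℝ≥0∞) (r : Set.Iic T) (k : M.K) :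
    M.opPair v r k = ∫⁻ q, (M.sojournCost k r q.1 + atJump v r q) ∂(M.Q k) := by
  have m1 : Measurable fun q : ℝ≥0 × E => (if (r : ℝ≥0) < q.1 then (1 : ℝ≥0∞) else 0) :=
    Measurable.ite (measurableSet_lt (by fun_prop) (by fun_prop)) (by fun_prop) (by fun_prop)
  have m2 : Measurable fun q : ℝ≥0 × E => ((min q.1 (r : ℝ≥0) : ℝ≥0) : ℝ≥0∞) := by fun_prop
  have m3 : Measurable fun q : ℝ≥0 × E => M.sojournCost k r q.1 := by
    unfold sojournCost
    fun_prop
  rw [opPair, lintegral_one_sub_semiQ, one_sub_semiQ, lintegral_add_left m3]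
  congr 1
  · unfold sojournCost
    rw [lintegral_add_left (by fun_prop), lintegral_const_mul _ m2, lintegral_const_mul _ m1]
  · rw [← lintegral_indicator (measurableSet_Iic.prod .univ)]
    refine lintegral_congr fun q => ?_
    by_cases h : q.1 ≤ r <;> simp [Set.indicator, atJump, h]

lemma measurable_opPair {v : Set.Iic T × E → ℝ≥0∞} (hv : Measurable v) :
    Measurable (fun p : Set.Iic T × M.K => M.opPair v p.1 p.2) := by
  simp_rw [opPair_eq_lintegral v]
  have h : Measurable (fun p : (Set.Iic T × M.K) × (ℝ≥0 × E) =>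
      M.sojournCost p.1.2 p.1.1 p.2.1 + atJump v p.1.1 p.2) := by
    refine Measurable.add ?_ ?_
    · exact measurable_sojournCost.comp
        (g := fun p : M.K × ℝ≥0 × ℝ≥0 => M.sojournCost p.1 p.2.1 p.2.2)
        (f := fun p : (Set.Iic T × M.K) × (ℝ≥0 × E) => (p.1.2, (p.1.1 : ℝ≥0), p.2.1))
        (by fun_prop)
    · exact (measurable_atJump hv).comp
        (f := fun p : (Set.Iic T × M.K) × (ℝ≥0 × E) => (p.1.1, p.2)) (by fun_prop)
  exact h.lintegral_kernel_prod_right' (κ := M.Q.comap Prod.snd measurable_snd)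

lemma opPair_mono {v w : Set.Iic T × E → ℝ≥0∞} (h : v ≤ w) (r : Set.Iic T) (k : M.K) :
    M.opPair v r k ≤ M.opPair w r k := by
  unfold opPair
  gcongr
  exact h _

lemma opPair_iSup {v : ℕ → Set.Iic T × E → ℝ≥0∞} (hv : ∀ n, Measurable (v n)) (hmono : Monotone v)
    (r : Set.Iic T) (k : M.K) : M.opPair (⨆ n, v n) r k = ⨆ n, M.opPair (v n) r k := by
  unfold opPair
  rw [← ENNReal.add_iSup]
  congr 1
  simp_rw [iSup_apply]
  rw [lintegral_iSup]
  · exact fun n => (hv n).comp (by fun_prop)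
  · exact fun m n h q => hmono h _

lemma opAct_mono {v w : Set.Iic T × E → ℝ≥0∞} (h : v ≤ w) (a : A) (p : Set.Iic T × E) :
    M.opAct a v p ≤ M.opAct a w p := by
  by_cases ha : a ∈ M.adm p.2
  · rw [opAct_of_mem ha, opAct_of_mem ha]
    exact opPair_mono h _ _
  · rw [opAct_of_notMem ha, opAct_of_notMem ha]

lemma opMin_mono {v w : Set.Iic T × E → ℝ≥0∞} (h : v ≤ w) : M.opMin v ≤ M.opMin w :=
  fun p => Finset.inf_mono_fun fun a _ => opAct_mono h a p

lemma opMin_le_opPair (v : Set.Iic T × E → ℝ≥0∞) (r : Set.Iic T) (k : M.K) :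
    M.opMin v (r, k.1.1) ≤ M.opPair v r k := by
  have h : k.1.2 ∈ M.adm (r, k.1.1).2 := k.2
  exact (Finset.inf_le h).trans_eq (opAct_of_mem h)

/-- Minima over a finite set of actions commute with monotone limits. -/
lemma opMin_iSup {v : ℕ → Set.Iic T × E → ℝ≥0∞} (hv : ∀ n, Measurable (v n)) (hmono : Monotone v) :
    M.opMin (⨆ n, v n) = ⨆ n, M.opMin (v n) := by
  classical
  funext p
  have key : ∀ s : Finset A, (∀ a ∈ s, a ∈ M.adm p.2) →
      (s.inf fun a => M.opAct a (⨆ n, v n) p) = ⨆ n, s.inf fun a => M.opAct a (v n) p := by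
    intro s
    induction s using Finset.induction_on with
    | empty => simp
    | insert a s ha ih =>
      intro hs
      simp_rw [Finset.inf_insert]
      rw [ih fun b hb => hs b (Finset.mem_insert_of_mem hb),
        iSup_inf_of_monotone (fun m n h => opAct_mono (hmono h) a p)
          (fun m n h => Finset.inf_mono_fun fun b _ => opAct_mono (hmono h) b p)]
      congr 1
      have hmem := hs a (Finset.mem_insert_self a s)
      simp_rw [opAct_of_mem hmem]
      exact opPair_iSup hv hmono _ _
  rw [iSup_apply]
  exact key _ fun a ha => ha

lemma opMin_eq_iInf (v : Set.Iic T × E → ℝ≥0∞) (p : Set.Iic T × E) :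
    M.opMin v p = ⨅ a, M.opAct a v p := by
  refine le_antisymm (le_iInf fun a => ?_) (Finset.le_inf fun a _ => iInf_le _ a)
  by_cases ha : a ∈ M.adm p.2
  · exact Finset.inf_le ha
  · simp [opAct_of_notMem ha]

lemma measurableSet_mem_adm [DiscreteMeasurableSpace A] (a : A) :
    MeasurableSet {x : E | a ∈ M.adm x} :=
  (measurable_prodMk_right (y := a)) M.measurableSet_graph

lemma measurable_opAct [DiscreteMeasurableSpace A] {v : Set.Iic T × E → ℝ≥0∞} (hv : Measurable v)
    (a : A) : Measurable (M.opAct a v) := by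
  classical
  have hs : MeasurableSet {p : Set.Iic T × E | a ∈ M.adm p.2} :=
    measurable_snd (measurableSet_mem_adm a)
  refine measurable_of_restrict_of_restrict_compl hs ?_ ?_
  · have : Set.domRestrict {p : Set.Iic T × E | a ∈ M.adm p.2} (M.opAct a v) =
        fun p => M.opPair v p.1.1 ⟨(p.1.2, a), p.2⟩ := by
      funext p
      exact opAct_of_mem p.2
    rw [this]
    exact (measurable_opPair hv).comp
      (f := fun p : {p : Set.Iic T × E | a ∈ M.adm p.2} =>
        (p.1.1, (⟨(p.1.2, a), p.2⟩ : M.K))) (by fun_prop)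
  · have : Set.domRestrict {p : Set.Iic T × E | a ∈ M.adm p.2}ᶜ (M.opAct a v) = fun _ => ⊤ := by
      funext p
      exact opAct_of_notMem p.2
    rw [this]
    exact measurable_const

lemma measurable_opMin [DiscreteMeasurableSpace A] [Countable A] {v : Set.Iic T × E → ℝ≥0∞}
    (hv : Measurable v) : Measurable (M.opMin v) := by
  have : M.opMin v = fun p => ⨅ a, M.opAct a v p := funext (opMin_eq_iInf v)
  rw [this]
  exact Measurable.iInf fun a => measurable_opAct hv a

end OneStep

/-! ### Value iteration and measurable minimizers -/

section ValueIteration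

variable {M : SMDP E A} {T : ℝ≥0}

lemma measurable_valueIter [DiscreteMeasurableSpace A] [Countable A] (n : ℕ) :
    Measurable (M.valueIter T n) := by
  induction n with
  | zero => exact measurable_const
  | succ n ih => exact measurable_opMin ih

lemma monotone_valueIter : Monotone (M.valueIter T) := by
  refine monotone_nat_of_le_succ fun n => ?_
  induction n with
  | zero => exact fun _ => zero_le
  | succ n ih => exact opMin_mono ih

lemma opMin_iSup_valueIter [DiscreteMeasurableSpace A] [Countable A] :
    M.opMin (⨆ n, M.valueIter T n) = ⨆ n, M.valueIter T n := by
  rw [opMin_iSup measurable_valueIter monotone_valueIter]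
  exact monotone_valueIter.iSup_nat_add 1

lemma iSup_valueIter_le {u : Set.Iic T × E → ℝ≥0∞} (hu : u = M.opMin u) :
    ⨆ n, M.valueIter T n ≤ u := by
  refine iSup_le fun n => ?_
  induction n with
  | zero => exact fun _ => zero_le
  | succ n ih =>
    rw [hu]
    exact opMin_mono ih

/-- A measurable relation into a countable discrete space that is total has a measurable
selection: take the first related element in an enumeration. -/
lemma exists_measurable_selection {X A : Type*} [MeasurableSpace X] [MeasurableSpace A]
    [DiscreteMeasurableSpace A] [Countable A] {R : X → A → Prop}
    (hR : ∀ a, MeasurableSet {x | R x a}) (hex : ∀ x, ∃ a, R x a) :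
    ∃ f : X → A, Measurable f ∧ ∀ x, R x (f x) := by
  classical
  obtain ⟨e, he⟩ := exists_injective_nat A
  have hex' : ∀ x, ∃ n, ∃ a, e a = n ∧ R x a := fun x => by
    obtain ⟨a, ha⟩ := hex x
    exact ⟨e a, a, rfl, ha⟩
  have hm : Measurable fun x => Nat.find (hex' x) := by
    refine measurable_find hex' fun n => ?_
    simp only [Set.ofPred_exists, Set.ofPred_and]
    exact MeasurableSet.iUnion fun a => (MeasurableSet.const _).inter (hR a)
  choose f hf1 hf2 using fun x => Nat.find_spec (hex' x)
  refine ⟨f, measurable_to_countable' fun a => ?_, hf2⟩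
  have : f ⁻¹' {a} = (fun x => Nat.find (hex' x)) ⁻¹' {e a} := by
    ext x
    simp only [Set.mem_preimage, Set.mem_singleton_iff]
    rw [← hf1 x, he.eq_iff]
  rw [this]
  exact hm (measurableSet_singleton _)

lemma opSel_apply [DiscreteMeasurableSpace A] (f : M.Selector) (v : Set.Iic T × E → ℝ≥0∞)
    (p : Set.Iic T × E) :
    M.opSel f v p = M.opPair v p.1
      ⟨(p.2, f.toFun (((p.1 : ℝ≥0) : ℝ), p.2)), f.admissible _ _⟩ := by
  have hmem := f.admissible ((p.1 : ℝ≥0) : ℝ) p.2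
  rw [← opAct_of_mem hmem, opSel, opRand, Finset.sum_eq_single_of_mem _ hmem]
  · simp [Selector.toRand, Kernel.deterministic_apply]
  · intro b _ hb
    simp [Selector.toRand, Kernel.deterministic_apply, hb.symm]

lemma exists_selector_opSel_eq_opMin [DiscreteMeasurableSpace A] [Countable A]
    {v : Set.Iic T × E → ℝ≥0∞} (hv : Measurable v) :
    ∃ f : M.Selector, M.opSel f v = M.opMin v := by
  -- Horizons outside `[0, T]` are projected onto `[0, T]`.
  let clamp : ℝ × E → Set.Iic T × E :=
    fun p => (⟨min p.1.toNNReal T, Set.mem_Iic.2 (min_le_right _ _)⟩, p.2)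
  have hclamp : Measurable clamp := by fun_prop
  obtain ⟨f, hf, hR⟩ := exists_measurable_selection (X := ℝ × E) (A := A)
    (R := fun p a => a ∈ M.adm p.2 ∧ M.opAct a v (clamp p) = M.opMin v (clamp p))
    (fun a => (measurable_snd (measurableSet_mem_adm a)).inter (measurableSet_eq_fun
      ((measurable_opAct hv a).comp hclamp) ((measurable_opMin hv).comp hclamp)))
    (fun p => by
      obtain ⟨g, _, hg⟩ := M.exists_selector
      obtain ⟨a, ha, h⟩ := Finset.exists_mem_eq_inf (M.adm p.2) ⟨_, hg 0 p.2⟩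
        fun a => M.opAct a v (clamp p)
      exact ⟨a, ha, h.symm⟩)
  refine ⟨⟨f, hf, fun s x => (hR (s, x)).1⟩, ?_⟩
  funext p
  have hp : clamp (((p.1 : ℝ≥0) : ℝ), p.2) = p := by
    refine Prod.ext (Subtype.ext ?_) rfl
    have := Set.mem_Iic.1 p.1.2
    simpa only [clamp, Real.toNNReal_coe] using min_eq_left this
  have h := (hR (((p.1 : ℝ≥0) : ℝ), p.2)).2
  rw [hp] at h
  rw [opSel_apply, ← h]
  exact (opAct_of_mem _).symm

end ValueIteration

end SMDP

namespace SMDP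

variable {E A : Type*} [MeasurableSpace E] [MeasurableSpace A]

/-! ### The law of the trajectory one step ahead -/

section Law

variable {M : SMDP E A}

/-- Since `η` charges only admissible actions, restricting to admissible triples loses no mass. -/
lemma map_incl_stepLaw {B : Type*} [MeasurableSpace B] (ρ : Kernel B (ℝ≥0 × E))
    [IsMarkovKernel ρ] (η : Kernel (B × (ℝ≥0 × E)) A) [IsMarkovKernel η]
    (h : ∀ b t x, η (b, (t, x)) (M.adm x : Set A) = 1) (b : B) :
    (M.stepLaw ρ η b).map (Step.incl M) = (ρ ⊗ₖ η) b := by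
  have := M.isMarkovKernel_stepLaw ρ η h
  have h1 : (ρ ⊗ₖ η) b (Set.range (Step.incl M)) = 1 := by
    have h2 : M.stepLaw ρ η b Set.univ = 1 := measure_univ
    rwa [stepLaw, Kernel.comapRight_apply' _ _ _ .univ, Set.image_univ] at h2
  rw [stepLaw, Kernel.comapRight_apply, Step.measurableEmbedding_incl.map_comap]
  refine Measure.restrict_eq_self_of_ae_mem ?_
  exact (prob_compl_eq_zero_iff Step.measurableSet_range_incl).2 h1

lemma map_fst_stepLaw {B : Type*} [MeasurableSpace B] (ρ : Kernel B (ℝ≥0 × E))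
    [IsMarkovKernel ρ] (η : Kernel (B × (ℝ≥0 × E)) A) [IsMarkovKernel η]
    (h : ∀ b t x, η (b, (t, x)) (M.adm x : Set A) = 1) (b : B) :
    (M.stepLaw ρ η b).map (fun z => (z.1, z.2.1.1)) = ρ b := by
  have h1 : (fun z : M.Step => (z.1, z.2.1.1)) = Prod.fst ∘ Step.incl M := rfl
  rw [h1, ← Measure.map_map measurable_fst Step.measurableEmbedding_incl.measurable,
    map_incl_stepLaw ρ η h, ← Kernel.fst_apply, Kernel.fst_compProd]

lemma ae_stepLaw_action_eq [DiscreteMeasurableSpace A] {B : Type*} [MeasurableSpace B]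
    (ρ : Kernel B (ℝ≥0 × E)) [IsMarkovKernel ρ] (η : Kernel (B × (ℝ≥0 × E)) A) [IsMarkovKernel η]
    (h : ∀ b t x, η (b, (t, x)) (M.adm x : Set A) = 1) (b : B) (φ : ℝ≥0 × E → A)
    (hφ : MeasurableSet {q : (ℝ≥0 × E) × A | q.2 = φ q.1})
    (hη : ∀ q, η (b, q) = Measure.dirac (φ q)) :
    ∀ᵐ z ∂(M.stepLaw ρ η b), z.2.1.2 = φ (z.1, z.2.1.1) := by
  have h1 : ∀ᵐ q ∂((M.stepLaw ρ η b).map (Step.incl M)), q.2 = φ q.1 := by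
    rw [map_incl_stepLaw ρ η h, Kernel.ae_compProd_iff hφ]
    refine Filter.Eventually.of_forall fun q => ?_
    rw [hη q, ae_dirac_eq]
    exact rfl
  exact Step.measurableEmbedding_incl.ae_map_iff.1 h1

instance (π : M.Policy) (s : ℝ) (x : E) : IsProbabilityMeasure (π.initial s x) := by
  have := M.isMarkovKernel_stepLaw
    (Kernel.const Unit (Measure.dirac ((0 : ℝ≥0), x)))
    ((π.kernel 0).comap (fun q : Unit × (ℝ≥0 × E) => (s, (Fin.elim0, q.2.2))) (by fun_prop))
    (fun b t y => π.admissible 0 s (Fin.elim0, y))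
  exact this.isProbabilityMeasure ()

instance (π : M.Policy) (s : ℝ) (x : E) : IsProbabilityMeasure (π.law s x) := by
  unfold Policy.law
  infer_instance

lemma map_zero_law (π : M.Policy) (s : ℝ) (x : E) :
    (π.law s x).map (fun ω => ω 0) = π.initial s x := by
  have h : (fun ω : M.Path => ω 0) =
      (fun z : (Π _ : Finset.Iic 0, M.Step) => z ⟨0, Finset.mem_Iic.2 le_rfl⟩) ∘
        Preorder.frestrictLe (π := fun _ => M.Step) 0 := rfl
  rw [h, ← Measure.map_map (by fun_prop) (by fun_prop), Policy.law, Kernel.trajMeasure,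
    Measure.map_comp _ _ (by fun_prop), Kernel.traj_map_frestrictLe, Kernel.partialTraj_self,
    Measure.id_comp, Measure.map_map (by fun_prop) (by fun_prop)]
  exact Measure.map_id

lemma lintegral_law_succ (π : M.Policy) (s : ℝ) (x : E) (n : ℕ)
    {F : (Π _ : Finset.Iic n, M.Step) × M.Step → ℝ≥0∞} (hF : Measurable F) :
    ∫⁻ ω, F (Preorder.frestrictLe (π := fun _ => M.Step) n ω, ω (n + 1)) ∂(π.law s x) =
      ∫⁻ ω, ∫⁻ z, F (Preorder.frestrictLe (π := fun _ => M.Step) n ω, z)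
        ∂(π.transition s n (Preorder.frestrictLe (π := fun _ => M.Step) n ω)) ∂(π.law s x) := by
  have h := Kernel.map_frestrictLe_trajMeasure_compProd_eq_map_trajMeasure
    (μ₀ := π.initial s x) (κ := π.transition s) (X := fun _ => M.Step) (a := n)
  change (π.law s x).map (Preorder.frestrictLe n) ⊗ₘ π.transition s n =
    (π.law s x).map (fun ω => (Preorder.frestrictLe n ω, ω (n + 1))) at h
  rw [← lintegral_map (μ := π.law s x)
    (g := fun ω => (Preorder.frestrictLe (π := fun _ => M.Step) n ω, ω (n + 1))) hF (by fun_prop),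
    ← h, Measure.lintegral_compProd hF,
    lintegral_map (hF.lintegral_kernel_prod_right' (κ := π.transition s n)) (by fun_prop)]

/-- Given the jump time `S_n` and the pair `(x_n, a_n)`, the next sojourn time and state have law
`Q(· | x_n, a_n)`, whatever the policy. -/
lemma lintegral_law_jump (π : M.Policy) (s : ℝ) (x : E) (n : ℕ)
    {F : (ℝ≥0 × M.K) × (ℝ≥0 × E) → ℝ≥0∞} (hF : Measurable F) :
    ∫⁻ ω, F ((jumpTime ω n, (ω n).2), ((ω (n + 1)).1, (ω (n + 1)).2.1.1)) ∂(π.law s x) =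
      ∫⁻ ω, ∫⁻ q, F ((jumpTime ω n, (ω n).2), q) ∂(M.Q (ω n).2) ∂(π.law s x) := by
  let σ : (Π _ : Finset.Iic n, M.Step) → ℝ≥0 :=
    fun z => ∑ i : Fin n, (z ⟨i + 1, Finset.mem_Iic.2 i.2⟩).1
  have hσ : Measurable σ := by fun_prop
  have hσ' : ∀ ω : M.Path, σ (Preorder.frestrictLe n ω) = jumpTime ω n := fun ω =>
    Fin.sum_univ_eq_sum_range (fun i => (ω (i + 1)).1) n
  have h := lintegral_law_succ π s x n
    (F := fun p => F ((σ p.1, (p.1 ⟨n, Finset.mem_Iic.2 le_rfl⟩).2), (p.2.1, p.2.2.1.1)))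
    (hF.comp (by fun_prop))
  simp only [hσ'] at h
  refine h.trans (lintegral_congr fun ω => ?_)
  have h2 := map_fst_stepLaw (M := M)
    (M.Q.comap (fun z : (Π _ : Finset.Iic n, M.Step) => (z ⟨n, Finset.mem_Iic.2 le_rfl⟩).2)
      (by fun_prop))
    ((π.kernel (n + 1)).comap _ (M.measurable_remaining_extendHist s n))
    (fun z t y => π.admissible (n + 1) (M.remaining s n z t) (M.extendHist n z t y))
    (Preorder.frestrictLe n ω)
  rw [Kernel.comap_apply] at h2
  change Measure.map _ _ = M.Q (ω n).2 at h2
  have hF' : Measurable fun q : ℝ≥0 × E => F ((jumpTime ω n, (ω n).2), q) :=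
    hF.comp (by fun_prop)
  rw [← h2, lintegral_map hF' (by fun_prop)]
  rfl

lemma lintegral_law_zero_state (π : M.Policy) (s : ℝ) (x : E) {G : E → ℝ≥0∞} (hG : Measurable G) :
    ∫⁻ ω, G (ω 0).2.1.1 ∂(π.law s x) = G x := by
  have h1 := map_fst_stepLaw (M := M)
    (Kernel.const Unit (Measure.dirac ((0 : ℝ≥0), x)))
    ((π.kernel 0).comap (fun q : Unit × (ℝ≥0 × E) => (s, (Fin.elim0, q.2.2))) (by fun_prop))
    (fun b t y => π.admissible 0 s (Fin.elim0, y)) ()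
  change (π.initial s x).map _ = _ at h1
  rw [← map_zero_law, Measure.map_map (by fun_prop) (by fun_prop), Kernel.const_apply] at h1
  have hG' : Measurable fun q : ℝ≥0 × E => G q.2 := hG.comp measurable_snd
  have h2 := lintegral_map (μ := π.law s x) (f := fun q : ℝ≥0 × E => G q.2)
    (g := (fun z : M.Step => (z.1, z.2.1.1)) ∘ fun ω : M.Path => ω 0)
    hG' (by fun_prop)
  rw [h1, lintegral_dirac' _ hG'] at h2
  exact h2.symm

/-- Under a stationary policy `f`, the action at each epoch is almost surely the one that `f`
prescribes for the current state and the remaining horizon. -/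
lemma ae_law_selector_action [DiscreteMeasurableSpace A] [Countable A] (f : M.Selector) (s : ℝ)
    (x : E) (n : ℕ) : ∀ᵐ ω ∂(f.policy.law s x),
      (ω n).2.1.2 = f.toFun (s - (jumpTime ω n : ℝ≥0), (ω n).2.1.1) := by
  have hf := f.measurable
  cases n with
  | zero =>
    have h1 : ∀ᵐ z ∂(f.policy.initial s x), z.2.1.2 = f.toFun (s, z.2.1.1) := by
      refine ae_stepLaw_action_eq (M := M) _ _
        (fun b t y => f.policy.admissible 0 s (Fin.elim0, y)) () (fun q => f.toFun (s, q.2)) ?_ ?_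
      · exact measurableSet_eq_fun (by fun_prop) (by fun_prop)
      · intro q
        exact Kernel.deterministic_apply f.measurable (s, q.2)
    rw [← map_zero_law] at h1
    refine (ae_of_ae_map (measurable_pi_apply 0).aemeasurable h1).mono fun ω hω => ?_
    simpa [jumpTime] using hω
  | succ n =>
    let S : Set ((Π _ : Finset.Iic n, M.Step) × M.Step) :=
      {p | p.2.2.1.2 = f.toFun (M.remaining s n p.1 p.2.1, p.2.2.1.1)}
    have hS : MeasurableSet S := by
      refine measurableSet_eq_fun (by fun_prop) (hf.comp (Measurable.prodMk ?_ (by fun_prop)))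
      unfold remaining
      fun_prop
    have h := Kernel.map_frestrictLe_trajMeasure_compProd_eq_map_trajMeasure
      (μ₀ := f.policy.initial s x) (κ := f.policy.transition s) (X := fun _ => M.Step) (a := n)
    have h1 : ∀ᵐ p ∂(((f.policy.law s x).map
        (fun ω => (Preorder.frestrictLe (π := fun _ => M.Step) n ω, ω (n + 1))))), p ∈ S := by
      refine (congrArg (fun μ => ∀ᵐ p ∂μ, p ∈ S) h).mp ?_
      refine (Measure.ae_compProd_iff (p := (· ∈ S)) hS).2 ?_
      refine Filter.Eventually.of_forall fun z => ?_
      refine ae_stepLaw_action_eq (M := M) _ _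
        (fun z t y => f.policy.admissible (n + 1) (M.remaining s n z t) (M.extendHist n z t y)) z
        (fun q => f.toFun (M.remaining s n z q.1, q.2)) ?_ ?_
      · refine measurableSet_eq_fun (by fun_prop)
          (hf.comp (Measurable.prodMk ?_ (by fun_prop)))
        unfold remaining
        fun_prop
      · intro q
        exact Kernel.deterministic_apply f.measurable (M.remaining s n z q.1, q.2)
    refine (ae_of_ae_map (by fun_prop) h1).mono fun ω hω => ?_
    have h2 : M.remaining s n (Preorder.frestrictLe n ω) (ω (n + 1)).1 =
        s - (jumpTime ω (n + 1) : ℝ≥0) := by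
      rw [remaining, jumpTime, Finset.sum_range_succ,
        ← Fin.sum_univ_eq_sum_range (fun i => (ω (i + 1)).1) n]
      rfl
    rw [← h2]
    exact hω

end Law

end SMDP

namespace SMDP

variable {E A : Type*} [MeasurableSpace E] [MeasurableSpace A]

/-! ### Splitting the cost along the jumps -/

section Splitting

variable {M : SMDP E A}

/-- The cost incurred up to the horizon `s` between the `n`-th and the `(n+1)`-st decision epoch. -/
noncomputable def stageCost (s : ℝ≥0) (n : ℕ) (ω : M.Path) : ℝ≥0∞ :=
  if jumpTime ω n ≤ s then M.sojournCost (ω n).2 (s - jumpTime ω n) (ω (n + 1)).1 else 0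

lemma jumpTime_succ (ω : M.Path) (n : ℕ) : jumpTime ω (n + 1) = jumpTime ω n + (ω (n + 1)).1 :=
  Finset.sum_range_succ _ _

lemma monotone_jumpTime (ω : M.Path) : Monotone (jumpTime ω) :=
  monotone_nat_of_le_succ fun n => (jumpTime_succ ω n).symm ▸ le_self_add

@[fun_prop]
lemma measurable_jumpTime (n : ℕ) : Measurable fun ω : M.Path => jumpTime ω n := by
  unfold jumpTime
  fun_prop

lemma measurable_stageCost (s : ℝ≥0) (n : ℕ) : Measurable (M.stageCost s n) := by
  unfold stageCost
  refine Measurable.ite (measurableSet_le (by fun_prop) (by fun_prop)) ?_ measurable_const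
  exact measurable_sojournCost.comp
    (f := fun ω : M.Path => ((ω n).2, s - jumpTime ω n, (ω (n + 1)).1)) (by fun_prop)

/-- At each time at most one sojourn interval is active, so a cost that vanishes at the cemetery is
the sum of its contributions from the sojourn intervals. -/
lemma apply_process_eq_tsum (h : Option M.K → ℝ≥0∞) (h0 : h none = 0) (ω : M.Path) (t : ℝ≥0) :
    h (process ω t) =
      ∑' n, if jumpTime ω n ≤ t ∧ t < jumpTime ω (n + 1) then h (some (ω n).2) else 0 := by
  classical
  unfold process
  split_ifs with hex
  · have hspec := Nat.find_spec hex
    rw [tsum_eq_single (Nat.find hex)]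
    · rw [if_pos hspec]
    · intro m hm
      refine if_neg fun hm' => ?_
      rcases lt_or_gt_of_ne hm with hlt | hlt
      · exact absurd hm' (Nat.find_min hex hlt)
      · exact absurd (hspec.2.trans_le (monotone_jumpTime ω hlt)) (not_lt.2 hm'.1)
  · rw [h0]
    refine (ENNReal.tsum_eq_zero.2 fun n => if_neg fun hn => hex ⟨n, hn⟩).symm

lemma volume_sojourn (s a τ : ℝ≥0) :
    volume.restrict (Set.Icc (0 : ℝ) s) {t : ℝ | a ≤ t.toNNReal ∧ t.toNNReal < a + τ} =
      if a ≤ s then ((min τ (s - a) : ℝ≥0) : ℝ≥0∞) else 0 := by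
  have hset : MeasurableSet {t : ℝ | a ≤ t.toNNReal ∧ t.toNNReal < a + τ} :=
    (measurableSet_le (by fun_prop) (by fun_prop)).inter
      (measurableSet_lt (by fun_prop) (by fun_prop))
  rw [Measure.restrict_apply hset]
  have key : ∀ t : ℝ, 0 ≤ t →
      ((a ≤ t.toNNReal ∧ t.toNNReal < a + τ) ↔ ((a : ℝ) ≤ t ∧ t < a + τ)) := fun t ht => by
    rw [Real.le_toNNReal_iff_coe_le ht, Real.toNNReal_lt_iff_lt_coe ht, NNReal.coe_add]
  split_ifs with has
  · have has' : (a : ℝ) ≤ s := has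
    have hlen : ENNReal.ofReal (((a : ℝ) + min (τ : ℝ) (s - a)) - a) =
        ((min τ (s - a) : ℝ≥0) : ℝ≥0∞) := by
      rw [add_sub_cancel_left, ← NNReal.coe_sub has, ← NNReal.coe_min, ENNReal.ofReal_coe_nnreal]
    apply le_antisymm
    · calc _ ≤ volume (Set.Icc (a : ℝ) (a + min (τ : ℝ) (s - a))) := by
            refine measure_mono fun t ht => ?_
            obtain ⟨h1, h2⟩ := (key t ht.2.1).1 ht.1
            refine ⟨h1, ?_⟩
            have h3 := ht.2.2
            rcases min_choice (τ : ℝ) (s - a) with h | h <;> rw [h] <;> linarith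
        _ = _ := by rw [Real.volume_Icc, hlen]
    · calc _ = volume (Set.Ico (a : ℝ) (a + min (τ : ℝ) (s - a))) := by
            rw [Real.volume_Ico, hlen]
        _ ≤ _ := by
            refine measure_mono fun t ht => ?_
            have h1 := ht.2
            have h2 := min_le_left (τ : ℝ) (s - a)
            have h3 := min_le_right (τ : ℝ) (s - a)
            have h4 : 0 ≤ t := a.2.trans ht.1
            exact ⟨(key t h4).2 ⟨ht.1, by linarith⟩, h4, by linarith⟩
  · refine measure_mono_null (t := ∅) (fun t ht => ?_) measure_empty
    have h1 := (key t ht.2.1).1 ht.1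
    exact has (NNReal.coe_le_coe.1 (h1.1.trans ht.2.2))

lemma totalCost_eq_tsum_stageCost (s : ℝ≥0) (ω : M.Path) :
    (∫⁻ t in Set.Icc (0 : ℝ) s, M.costOpt (process ω t.toNNReal)) + M.termOpt (process ω s) =
      ∑' n, stageCost s n ω := by
  have hset : ∀ n, MeasurableSet
      {t : ℝ | jumpTime ω n ≤ t.toNNReal ∧ t.toNNReal < jumpTime ω (n + 1)} := fun n =>
    (measurableSet_le (by fun_prop) (by fun_prop)).inter
      (measurableSet_lt (by fun_prop) (by fun_prop))
  simp_rw [apply_process_eq_tsum M.costOpt rfl, apply_process_eq_tsum M.termOpt rfl]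
  rw [lintegral_tsum fun n =>
    (Measurable.ite (hset n) measurable_const measurable_const).aemeasurable, ← ENNReal.tsum_add]
  refine tsum_congr fun n => ?_
  have h1 : ∀ t : ℝ, (if jumpTime ω n ≤ t.toNNReal ∧ t.toNNReal < jumpTime ω (n + 1) then
      M.costOpt (some (ω n).2) else 0) =
      {t : ℝ | jumpTime ω n ≤ t.toNNReal ∧ t.toNNReal < jumpTime ω (n + 1)}.indicator
        (fun _ => M.costOpt (some (ω n).2)) t := fun t => by simp [Set.indicator]
  simp_rw [h1]
  rw [lintegral_indicator_const (hset n), jumpTime_succ, volume_sojourn, stageCost]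
  by_cases h : jumpTime ω n ≤ s
  · simp only [h, if_true, true_and, sojournCost, costOpt, termOpt, Option.elim_some,
      tsub_lt_iff_left h]
    simp
  · simp [h]

lemma expCost_eq_tsum (π : M.Policy) (s : ℝ≥0) (x : E) :
    π.expCost s x = ∑' n, ∫⁻ ω, stageCost s n ω ∂(π.law s x) := by
  simp_rw [Policy.expCost, totalCost_eq_tsum_stageCost]
  exact lintegral_tsum fun n => (measurable_stageCost s n).aemeasurable

end Splitting

/-! ### The one-step recursion and its consequences -/

section Recursion

variable {M : SMDP E A} {T : ℝ≥0}

/-- The one-step identity: the expected cost of stage `n` plus the expectation of `v` at the next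
epoch is the expectation of the one-step operator at the pair `(x_n, a_n)`. -/
lemma lintegral_stageCost_add_atJump {v : Set.Iic T × E → ℝ≥0∞} (hv : Measurable v) (π : M.Policy)
    (s : Set.Iic T) (x : E) (n : ℕ) :
    ∫⁻ ω, stageCost (s : ℝ≥0) n ω ∂(π.law (s : ℝ≥0) x) +
        ∫⁻ ω, atJump v s (jumpTime ω (n + 1), (ω (n + 1)).2.1.1) ∂(π.law (s : ℝ≥0) x) =
      ∫⁻ ω, atJump (E := M.K) (fun p => M.opPair v p.1 p.2) s (jumpTime ω n, (ω n).2)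
        ∂(π.law (s : ℝ≥0) x) := by
  let F : (ℝ≥0 × M.K) × (ℝ≥0 × E) → ℝ≥0∞ := fun p =>
    (if p.1.1 ≤ s then M.sojournCost p.1.2 (s - p.1.1) p.2.1 else 0) +
      atJump v s (p.1.1 + p.2.1, p.2.2)
  have hF : Measurable F := by
    refine Measurable.add (Measurable.ite (measurableSet_le (by fun_prop) (by fun_prop)) ?_
      measurable_const) ?_
    · exact measurable_sojournCost.comp
        (f := fun p : (ℝ≥0 × M.K) × (ℝ≥0 × E) => (p.1.2, (s : ℝ≥0) - p.1.1, p.2.1)) (by fun_prop)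
    · exact (measurable_atJump hv).comp
        (f := fun p : (ℝ≥0 × M.K) × (ℝ≥0 × E) => (s, (p.1.1 + p.2.1, p.2.2))) (by fun_prop)
  rw [← lintegral_add_left (measurable_stageCost _ n)]
  simp_rw [jumpTime_succ]
  refine (lintegral_law_jump π (s : ℝ≥0) x n hF).trans (lintegral_congr fun ω => ?_)
  by_cases h : jumpTime ω n ≤ s
  · simp only [F, h, if_true]
    rw [atJump, if_pos h, opPair_eq_lintegral]
    refine lintegral_congr fun q => ?_
    simp only [atJump, le_tsub_iff_left h, tsub_tsub]
  · have h' : ∀ τ : ℝ≥0, ¬ jumpTime ω n + τ ≤ s := fun τ hτ => h (le_self_add.trans hτ)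
    simp [F, atJump, h, h']

lemma lintegral_atJump_zero {v : Set.Iic T × E → ℝ≥0∞} (hv : Measurable v) (π : M.Policy)
    (s : Set.Iic T) (x : E) :
    ∫⁻ ω, atJump v s (jumpTime ω 0, (ω 0).2.1.1) ∂(π.law (s : ℝ≥0) x) = v (s, x) := by
  have h := lintegral_law_zero_state π (s : ℝ≥0) x (G := fun y => v (s, y)) (hv.comp (by fun_prop))
  rw [← h]
  refine lintegral_congr fun ω => ?_
  simp [atJump, jumpTime]

/-- Whatever the policy, the stages `m, …, m + n - 1` cost in expectation at least the `n`-th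
value iterate at epoch `m`. -/
lemma lintegral_atJump_valueIter_le [DiscreteMeasurableSpace A] [Countable A] (π : M.Policy)
    (s : Set.Iic T) (x : E) (n m : ℕ) :
    ∫⁻ ω, atJump (M.valueIter T n) s (jumpTime ω m, (ω m).2.1.1) ∂(π.law (s : ℝ≥0) x) ≤
      ∑ k ∈ Finset.range n, ∫⁻ ω, stageCost (s : ℝ≥0) (m + k) ω ∂(π.law (s : ℝ≥0) x) := by
  induction n generalizing m with
  | zero => simp [atJump, valueIter]
  | succ n ih =>
    have hstep : ∫⁻ ω, atJump (M.valueIter T (n + 1)) s (jumpTime ω m, (ω m).2.1.1)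
          ∂(π.law (s : ℝ≥0) x) ≤
        ∫⁻ ω, atJump (E := M.K) (fun p => M.opPair (M.valueIter T n) p.1 p.2) s
          (jumpTime ω m, (ω m).2) ∂(π.law (s : ℝ≥0) x) := by
      refine lintegral_mono fun ω => ?_
      unfold atJump
      split_ifs
      · exact opMin_le_opPair _ _ _
      · exact le_rfl
    refine hstep.trans ?_
    rw [← lintegral_stageCost_add_atJump (measurable_valueIter n) π s x m,
      Finset.sum_range_succ', add_comm, add_zero]
    gcongr
    refine (ih (m + 1)).trans_eq (Finset.sum_congr rfl fun k _ => ?_)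
    rw [add_assoc, add_comm 1 k]

lemma valueIter_le_expCost [DiscreteMeasurableSpace A] [Countable A] (π : M.Policy)
    (s : Set.Iic T) (x : E) (n : ℕ) : M.valueIter T n (s, x) ≤ π.expCost s x := by
  rw [← lintegral_atJump_zero (measurable_valueIter n) π s x, expCost_eq_tsum]
  refine (lintegral_atJump_valueIter_le π s x n 0).trans ?_
  simp only [zero_add]
  exact ENNReal.sum_le_tsum _

/-- A fixed point `u` of `𝕋^f` splits exactly into the cost of the first `n` stages under `f` and
the expectation of `u` at epoch `n`. -/
lemma sum_stageCost_add_atJump_eq [DiscreteMeasurableSpace A] [Countable A] {f : M.Selector}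
    {u : Set.Iic T × E → ℝ≥0∞} (hu : Measurable u) (hf : u = M.opSel f u) (s : Set.Iic T) (x : E)
    (n : ℕ) :
    ∑ k ∈ Finset.range n, ∫⁻ ω, stageCost (s : ℝ≥0) k ω ∂(f.policy.law (s : ℝ≥0) x) +
      ∫⁻ ω, atJump u s (jumpTime ω n, (ω n).2.1.1) ∂(f.policy.law (s : ℝ≥0) x) = u (s, x) := by
  induction n with
  | zero => simpa using lintegral_atJump_zero hu f.policy s x
  | succ n ih =>
    rw [Finset.sum_range_succ, add_assoc, lintegral_stageCost_add_atJump hu, ← ih]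
    congr 1
    refine lintegral_congr_ae ?_
    filter_upwards [ae_law_selector_action f (s : ℝ≥0) x n] with ω hω
    by_cases h : jumpTime ω n ≤ s
    · simp only [atJump, h, if_true]
      conv_rhs => rw [hf, opSel_apply]
      congr 1
      refine Subtype.ext (Prod.ext rfl ?_)
      simp only [NNReal.coe_sub h]
      exact hω
    · simp [atJump, h]

lemma expCost_le_of_eq_opSel [DiscreteMeasurableSpace A] [Countable A] {f : M.Selector}
    {u : Set.Iic T × E → ℝ≥0∞} (hu : Measurable u) (hf : u = M.opSel f u) (s : Set.Iic T) (x : E) :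
    f.policy.expCost s x ≤ u (s, x) := by
  rw [expCost_eq_tsum, ENNReal.tsum_eq_iSup_nat]
  exact iSup_le fun n => le_self_add.trans_eq (sum_stageCost_add_atJump_eq hu hf s x n)

lemma measurable_iSup_valueIter [DiscreteMeasurableSpace A] [Countable A] :
    Measurable (⨆ n, M.valueIter T n) := by
  have h : (⨆ n, M.valueIter T n) = fun p => ⨆ n, M.valueIter T n p := funext fun _ => iSup_apply
  rw [h]
  exact Measurable.iSup fun n => measurable_valueIter n

/-- Every policy costs at least the limit of the value iterates, and a selector attaining the
minimum in the optimality operator at that limit costs at most as much. -/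
lemma valueOn_eq_iSup_valueIter [DiscreteMeasurableSpace A] [Countable A] :
    M.valueOn T = ⨆ n, M.valueIter T n := by
  obtain ⟨f, hf⟩ := exists_selector_opSel_eq_opMin (M := M)
    (measurable_iSup_valueIter (M := M) (T := T))
  rw [opMin_iSup_valueIter] at hf
  funext p
  refine le_antisymm ?_ ?_
  · exact (iInf_le _ f.policy).trans
      (expCost_le_of_eq_opSel measurable_iSup_valueIter hf.symm p.1 p.2)
  · rw [iSup_apply]
    exact iSup_le fun n => le_iInf fun π => valueIter_le_expCost π p.1 p.2 n

lemma measurable_valueOn [DiscreteMeasurableSpace A] [Countable A] :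
    Measurable (M.valueOn T) := by
  rw [valueOn_eq_iSup_valueIter]
  exact measurable_iSup_valueIter

end Recursion

end SMDP

theorem mainTheorem1 {E A : Type*} [MeasurableSpace E] [StandardBorelSpace E]
    [MeasurableSpace A] [DiscreteMeasurableSpace A] [Countable A]
    (M : SMDP E A) (hM : M.NonExplosive) (T : ℝ≥0) :
    -- value iteration
    ((∀ n, Measurable (M.valueIter T n)) ∧ Monotone (M.valueIter T) ∧
      (∀ p, Tendsto (fun n => M.valueIter T n p) atTop (𝓝 (M.valueOn T p))) ∧
      Measurable (M.valueOn T)) ∧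
    -- optimality equation, with the value function as its minimal solution
    (M.valueOn T = M.opMin (M.valueOn T) ∧
      ∀ u : Set.Iic T × E → ℝ≥0∞, Measurable u → u = M.opMin u → M.valueOn T ≤ u) ∧
    -- existence of a minimizing selector, and optimality of every such selector
    ((∃ f : M.Selector, M.valueOn T = M.opSel f (M.valueOn T)) ∧
      ∀ f : M.Selector, M.valueOn T = M.opSel f (M.valueOn T) → f.policy.IsOptimal T) := by
  have hopt : M.valueOn T = M.opMin (M.valueOn T) := by
    rw [SMDP.valueOn_eq_iSup_valueIter, SMDP.opMin_iSup_valueIter]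
  refine ⟨⟨fun n => SMDP.measurable_valueIter n, SMDP.monotone_valueIter, fun p => ?_,
    SMDP.measurable_valueOn⟩, ⟨hopt, fun u _ hu => ?_⟩, ?_, fun f hf s hs x => ?_⟩
  · rw [SMDP.valueOn_eq_iSup_valueIter, iSup_apply]
    exact tendsto_atTop_iSup fun m n h => SMDP.monotone_valueIter h p
  · rw [SMDP.valueOn_eq_iSup_valueIter]
    exact SMDP.iSup_valueIter_le hu
  · obtain ⟨f, hf⟩ := SMDP.exists_selector_opSel_eq_opMin (M := M)
      (SMDP.measurable_valueOn (M := M) (T := T))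
    exact ⟨f, by rw [hf, ← hopt]⟩
  · exact le_antisymm (SMDP.expCost_le_of_eq_opSel SMDP.measurable_valueOn hf ⟨s, hs⟩ x)
      (iInf_le _ f.policy)
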